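/- Let $\mathbb{H}$ be the real quaternions and $\mathbb{H}[z]$ the ring of polynomials in a formal variable $z$ commuting with the coefficients. For $f(z)=\sum_k z^k f_k\in\mathbb{H}[z]$ and $\alpha\in\mathbb{H}$ define the left and right evaluations $f^{e_\ell}(\alpha)=\sum_k \alpha^k f_k$ and $f^{e_r}(\alpha)=\sum_k f_k\alpha^k$. Call $\alpha,\beta\in\mathbb{H}$ equivalent if $\alpha=h^{-1}\beta h$ for some nonzero $h\in\mathbb{H}$. Let $\Lambda=\{\alpha_1,\dots,\alpha_n\}$ and $\Omega=\{\beta_1,\dots,\beta_m\}$ be finite (possibly empty, not necessarily disjoint) sets of quaternions, with $\alpha_1,\dots,\alpha_n$ distinct, $\beta_1,\dots,\beta_m$ distinct, and $\Omega\cap\mathbb{R}=\emptyset$; let $c_1,\dots,c_n,d_1,\dots,d_m\in\mathbb{H}$. Assume that no three distinct elements of the set $\Lambda\cup\Omega$ are equivalent. Then there is a polynomial $f\in\mathbb{H}[z]$ with $$f^{e_\ell}(\alpha_i)=c_i\quad(1\le i\le n),\qquad f^{e_r}(\beta_j)=d_j\quad(1\le j\le m)$$ if and only if $\overline{\alpha_i}\,(c_i-d_j)=(c_i-d_j)\,\beta_j$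 for every pair $(\alpha_i,\beta_j)\in\Lambda\times\Omega$ of equivalent nodes. -/

import Mathlib

open scoped Quaternion Polynomial

/-- Left evaluation `∑ αᵏ fₖ` of a quaternionic polynomial `f = ∑ zᵏ fₖ` at `α`.
The right evaluation `∑ fₖ αᵏ` is Mathlib's `Polynomial.eval α f`, which writes the powers of the
point to the right of the coefficients. -/
noncomputable def leftEval (α : ℍ[ℝ]) (f : ℍ[ℝ][X]) : ℍ[ℝ] :=
  f.sum fun k a => α ^ k * a

/-- `f` solves the two-sided Lagrange problem with left conditions `(α i, c i)` and right
conditions `(β j, d j)`. -/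
def SolvesTwoSidedLagrange {n m : ℕ} (α c : Fin n → ℍ[ℝ]) (β d : Fin m → ℍ[ℝ])
    (f : ℍ[ℝ][X]) : Prop :=
  (∀ i, leftEval (α i) f = c i) ∧ ∀ j, f.eval (β j) = d j

/-- No three distinct elements of `S` are equivalent. Equivalence `b = h * a * h⁻¹`, `h ≠ 0`, is
Mathlib's `IsConj a b`, since the units of the division ring of quaternions are its nonzero
elements. -/
def NoThreeEquivalent (S : Set ℍ[ℝ]) : Prop :=
  ∀ a ∈ S, ∀ b ∈ S, ∀ c ∈ S, a ≠ b → b ≠ c → a ≠ c → ¬ (IsConj a b ∧ IsConj b c)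

open Polynomial

/-! Necessity: for equivalent `a`, `b` every difference of left and right values intertwines `star
a` and `b`; on monomials this follows from the quadratic real equation shared by `a` and `b`
(`star_mul_leftEval_sub_eval`). Sufficiency: real polynomials are central, so both evaluations are
multiplicative on them, and they separate conjugacy classes (`exists_separating`). It remains to
interpolate within one class, which contains at most two distinct nodes; a linear polynomial meets
two conditions, and compatibility forces any others (`exists_linear_solution`). -/

lemma leftEval_add (α : ℍ[ℝ]) (f g : ℍ[ℝ][X]) :
    leftEval α (f + g) = leftEval α f + leftEval α g :=
  sum_add_index f g _ (fun _ => mul_zero _) fun _ _ _ => mul_add _ _ _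

lemma leftEval_monomial (α : ℍ[ℝ]) (k : ℕ) (a : ℍ[ℝ]) :
    leftEval α (monomial k a) = α ^ k * a :=
  sum_monomial_index a _ (mul_zero _)

lemma leftEval_zero (α : ℍ[ℝ]) : leftEval α 0 = 0 := sum_zero_index _

lemma leftEval_sum {ι : Type*} (α : ℍ[ℝ]) (s : Finset ι) (f : ι → ℍ[ℝ][X]) :
    leftEval α (∑ k ∈ s, f k) = ∑ k ∈ s, leftEval α (f k) :=
  map_sum (⟨⟨leftEval α, leftEval_zero α⟩, leftEval_add α⟩ : ℍ[ℝ][X] →+ ℍ[ℝ]) f s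

lemma leftEval_linear (α a b : ℍ[ℝ]) : leftEval α (C a + X * C b) = a + α * b := by
  rw [leftEval_add, X_mul_C, C_mul_X_eq_monomial, ← monomial_zero_left, leftEval_monomial,
    leftEval_monomial]
  simp

/-- Left evaluation is multiplicative on products with a central (real) left factor. -/
lemma leftEval_map_mul (α : ℍ[ℝ]) (P : ℝ[X]) (g : ℍ[ℝ][X]) :
    leftEval α (P.map (algebraMap ℝ ℍ[ℝ]) * g) = aeval α P * leftEval α g := by
  induction P using Polynomial.induction_on' with
  | add p q hp hq => rw [Polynomial.map_add, add_mul, leftEval_add, hp, hq, map_add, add_mul]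
  | monomial n r =>
    induction g using Polynomial.induction_on' with
    | add p q hp hq => rw [mul_add, leftEval_add, hp, hq, leftEval_add, mul_add]
    | monomial k a =>
      rw [map_monomial, monomial_mul_monomial, leftEval_monomial, leftEval_monomial,
        aeval_monomial, pow_add, mul_assoc, mul_assoc, Algebra.left_comm, Algebra.left_comm]

/-- Right evaluation is multiplicative on products with a central (real) left factor. -/
lemma eval_map_mul (β : ℍ[ℝ]) (P : ℝ[X]) (g : ℍ[ℝ][X]) :
    (P.map (algebraMap ℝ ℍ[ℝ]) * g).eval β = g.eval β * aeval β P := by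
  induction P using Polynomial.induction_on' with
  | add p q hp hq => rw [Polynomial.map_add, add_mul, eval_add, hp, hq, map_add, mul_add]
  | monomial n r =>
    induction g using Polynomial.induction_on' with
    | add p q hp hq => rw [mul_add, eval_add, hp, hq, eval_add, add_mul]
    | monomial k a =>
      rw [map_monomial, monomial_mul_monomial, eval_monomial, eval_monomial,
        aeval_monomial, add_comm n k, pow_add, Algebra.commutes, mul_assoc, mul_assoc,
        ← mul_assoc (algebraMap ℝ ℍ[ℝ] r), Algebra.commutes, mul_assoc, Algebra.commutes]

/-! ### Conjugacy classes and the intertwining relation -/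

/-- The conjugacy invariants of a quaternion: its real part and the square of its norm. -/
noncomputable def conjInvariants (a : ℍ[ℝ]) : ℝ × ℝ := (a.re, Quaternion.normSq a)

lemma mul_self_eq_of_conjInvariants {a b : ℍ[ℝ]} (h : conjInvariants a = conjInvariants b) :
    b * b = ((2 * a.re : ℝ) : ℍ[ℝ]) * b - ((Quaternion.normSq a : ℝ) : ℍ[ℝ]) := by
  have h1 : a.re = b.re := congrArg Prod.fst h
  have h2 : Quaternion.normSq a = Quaternion.normSq b := congrArg Prod.snd h
  rw [h1, h2, ← Quaternion.self_mul_star, Quaternion.star_eq_two_re_sub, mul_sub,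
    Quaternion.coe_commutes]
  abel

lemma conjInvariants_eq_of_isConj {a b : ℍ[ℝ]} (h : IsConj a b) :
    conjInvariants a = conjInvariants b := by
  obtain ⟨c, hc, rfl⟩ := GroupWithZero.isConj_iff₀.1 h
  have hn : Quaternion.normSq c ≠ 0 := Quaternion.normSq_ne_zero.2 hc
  refine Prod.ext ?_ ?_
  · have hre : ∀ x y : ℍ[ℝ], (x * y).re = (y * x).re := fun x y => by
      simp only [Quaternion.re_mul]; ring
    change a.re = (c * a * c⁻¹).re
    rw [hre, ← mul_assoc, inv_mul_cancel₀ hc, one_mul]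
  · change Quaternion.normSq a = Quaternion.normSq (c * a * c⁻¹)
    rw [map_mul, map_mul, map_inv₀]
    field_simp

/-- Each `b * x - x * star a` intertwines `a` and `b`, so a nonzero one conjugates them. If all
vanish, `x = 1` gives `b = star a`, so `b` is central, hence real, and `a = b`. -/
lemma isConj_of_conjInvariants_eq {a b : ℍ[ℝ]} (h : conjInvariants a = conjInvariants b) :
    IsConj a b := by
  have hb := mul_self_eq_of_conjInvariants (rfl : conjInvariants b = _)
  have h1 : a.re = b.re := congrArg Prod.fst h
  have h2 : Quaternion.normSq a = Quaternion.normSq b := congrArg Prod.snd h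
  have key : ∀ x : ℍ[ℝ], (b * x - x * star a) * a = b * (b * x - x * star a) := fun x => by
    have e1 : (b * x - x * star a) * a
        = b * x * a - x * ((Quaternion.normSq b : ℝ) : ℍ[ℝ]) := by
      rw [sub_mul, mul_assoc x, Quaternion.star_mul_self, h2]
    have e2 : b * (b * x - x * star a) = b * b * x - b * x * ((2 * b.re : ℝ) : ℍ[ℝ])
        + b * x * a := by
      rw [Quaternion.star_eq_two_re_sub, h1]
      noncomm_ring
    rw [e1, e2, hb, sub_mul, ← Quaternion.coe_commutes _ x, ← Quaternion.coe_commutes _ (b * x),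
      ← mul_assoc]
    abel
  by_cases hx : ∃ x : ℍ[ℝ], b * x - x * star a ≠ 0
  · obtain ⟨x, hx⟩ := hx
    refine GroupWithZero.isConj_iff₀.2 ⟨_, hx, ?_⟩
    rw [key, mul_assoc, mul_inv_cancel₀ hx, mul_one]
  · push Not at hx
    have hs : b = star a := by simpa [sub_eq_zero] using hx 1
    have hc : ∀ x, b * x = x * b := fun x => by
      have := hx x
      rwa [← hs, sub_eq_zero] at this
    have hi := hc ⟨0, 1, 0, 0⟩
    have hj := hc ⟨0, 0, 1, 0⟩
    have hb2 : b.imK = 0 := by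
      have := (Quaternion.imJ_mul b ⟨0, 1, 0, 0⟩).symm.trans
        ((congrArg (fun q : ℍ[ℝ] => q.imJ) hi).trans (Quaternion.imJ_mul _ b))
      simp only [mul_zero, mul_one, zero_mul, one_mul] at this
      linarith
    have hb3 : b.imJ = 0 := by
      have := (Quaternion.imK_mul b ⟨0, 1, 0, 0⟩).symm.trans
        ((congrArg (fun q : ℍ[ℝ] => q.imK) hi).trans (Quaternion.imK_mul _ b))
      simp only [mul_zero, mul_one, zero_mul, one_mul] at this
      linarith
    have hb4 : b.imI = 0 := by
      have := (Quaternion.imK_mul b ⟨0, 0, 1, 0⟩).symm.trans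
        ((congrArg (fun q : ℍ[ℝ] => q.imK) hj).trans (Quaternion.imK_mul _ b))
      simp only [mul_zero, mul_one, zero_mul, one_mul] at this
      linarith
    have : a = b := by
      have h3 : a = star b := by rw [hs, star_star]
      rw [h3]
      ext <;> simp [hb2, hb3, hb4]
    rw [this]

lemma isConj_iff_conjInvariants_eq {a b : ℍ[ℝ]} :
    IsConj a b ↔ conjInvariants a = conjInvariants b :=
  ⟨conjInvariants_eq_of_isConj, isConj_of_conjInvariants_eq⟩

lemma star_mul_sub_eq {a b : ℍ[ℝ]} (h : conjInvariants a = conjInvariants b) (x : ℍ[ℝ]) :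
    star a * (a * x - x * b) = (a * x - x * b) * b := by
  have hb := mul_self_eq_of_conjInvariants h
  rw [mul_sub, sub_mul, mul_assoc x, hb, ← mul_assoc, Quaternion.star_mul_self,
    Quaternion.star_eq_two_re_sub, sub_mul, mul_sub, ← mul_assoc x,
    ← Quaternion.coe_commutes _ x, ← Quaternion.coe_commutes _ x, mul_assoc, mul_assoc]
  abel

/-- The relation between left and right values of a polynomial at equivalent points. -/
lemma star_mul_leftEval_sub_eval {a b : ℍ[ℝ]} (h : conjInvariants a = conjInvariants b)
    (f : ℍ[ℝ][X]) :
    star a * (leftEval a f - f.eval b) = (leftEval a f - f.eval b) * b := by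
  induction f using Polynomial.induction_on' with
  | add p q hp hq =>
    rw [leftEval_add, eval_add, add_sub_add_comm, mul_add, add_mul, hp, hq]
  | monomial k x =>
    rw [leftEval_monomial, eval_monomial]
    induction k with
    | zero => simp
    | succ k ih =>
      -- Telescoping: the induction hypothesis covers the first summand, the degree-one case the
      -- second.
      have e : a ^ (k + 1) * x - x * b ^ (k + 1)
          = a * (a ^ k * x - x * b ^ k) + (a * x - x * b) * b ^ k := by
        rw [pow_succ', pow_succ']
        noncomm_ring
      have hc : star a * a = a * star a := by
        rw [Quaternion.star_mul_self, Quaternion.self_mul_star]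
      rw [e, mul_add, add_mul, ← mul_assoc, hc, mul_assoc, ih, ← mul_assoc, ← mul_assoc,
        star_mul_sub_eq h, mul_assoc _ b, mul_assoc _ (b ^ k), ← pow_succ, ← pow_succ']

/-! ### Separating classes by real polynomials -/

/-- The left side of `h` is the resultant of `X² - 2pX + n` and `X² - 2qX + m`. Completing the
square makes it a sum of two nonnegative terms, which must both vanish. -/
lemma eq_and_eq_of_resultant_eq_zero {p n q m A B : ℝ} (hA : 0 ≤ A) (hB : 0 ≤ B)
    (hn : n = p ^ 2 + A) (hm : m = q ^ 2 + B)
    (h : (2 * (p - q)) ^ 2 * n + 2 * (2 * (p - q)) * (m - n) * p + (m - n) ^ 2 = 0) :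
    p = q ∧ n = m := by
  have e : (2 * (p - q) * p + (m - n)) ^ 2 + (2 * (p - q)) ^ 2 * A = 0 := by
    rw [← h, hn]; ring
  have hsA : 0 ≤ (2 * (p - q)) ^ 2 * A := by positivity
  have e1 : 2 * (p - q) * p + (m - n) = 0 := by
    refine pow_eq_zero_iff two_ne_zero |>.1 (le_antisymm ?_ (sq_nonneg _))
    linarith
  have e2 : (2 * (p - q)) ^ 2 * A = 0 := by rw [e1] at e; linarith
  have hpq : p = q := by
    rcases mul_eq_zero.1 e2 with e3 | e3
    · have := pow_eq_zero_iff two_ne_zero |>.1 e3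
      linarith
    · have e4 : (p - q) ^ 2 + B = 0 := by
        rw [hm, hn, e3] at e1
        linarith
      have e5 : (p - q) ^ 2 = 0 := le_antisymm (by linarith) (sq_nonneg _)
      exact sub_eq_zero.1 (pow_eq_zero_iff two_ne_zero |>.1 e5)
  refine ⟨hpq, ?_⟩
  rw [hpq] at e1
  linarith

/-- The characteristic polynomial `X² - 2 re(a) X + |a|²` of a quaternion. -/
noncomputable def conjPolynomial (a : ℍ[ℝ]) : ℝ[X] :=
  X ^ 2 - C (2 * a.re) * X + C (Quaternion.normSq a)

lemma aeval_conjPolynomial {a x : ℍ[ℝ]} (h : conjInvariants x = conjInvariants a) :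
    aeval x (conjPolynomial a) = 0 := by
  have e : aeval x (conjPolynomial a)
      = x * x - ((2 * a.re : ℝ) : ℍ[ℝ]) * x + ((Quaternion.normSq a : ℝ) : ℍ[ℝ]) := by
    rw [conjPolynomial, map_add, map_sub, map_mul, aeval_C, aeval_C, map_pow, aeval_X, pow_two]
    rfl
  rw [e, mul_self_eq_of_conjInvariants h.symm]
  abel

lemma exists_separating_pair {a b : ℍ[ℝ]} (h : conjInvariants a ≠ conjInvariants b) :
    ∃ P : ℝ[X], (∀ x, conjInvariants x = conjInvariants a → aeval x P = 1) ∧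
      ∀ x, conjInvariants x = conjInvariants b → aeval x P = 0 := by
  obtain ⟨s, hs⟩ : ∃ s : ℝ, s = 2 * (a.re - b.re) := ⟨_, rfl⟩
  obtain ⟨t, ht⟩ : ∃ t : ℝ, t = Quaternion.normSq b - Quaternion.normSq a := ⟨_, rfl⟩
  obtain ⟨D, hD⟩ : ∃ D : ℝ, D = s ^ 2 * Quaternion.normSq a + 2 * s * t * a.re + t ^ 2 := ⟨_, rfl⟩
  have hD0 : D ≠ 0 := by
    intro h0
    rw [hD, hs, ht] at h0
    obtain ⟨e₁, e₂⟩ := eq_and_eq_of_resultant_eq_zero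
      (A := a.imI ^ 2 + a.imJ ^ 2 + a.imK ^ 2) (B := b.imI ^ 2 + b.imJ ^ 2 + b.imK ^ 2)
      (by positivity) (by positivity) ((Quaternion.normSq_def' a).trans (by ring))
      ((Quaternion.normSq_def' b).trans (by ring)) h0
    exact h (Prod.ext e₁ e₂)
  have hb : conjPolynomial b = conjPolynomial a + C s * X + C t := by
    rw [conjPolynomial, conjPolynomial, hs, ht]
    simp only [C_mul, C_sub]
    ring
  -- A Bézout identity: modulo `conjPolynomial a`, `conjPolynomial b` is `s X + t`, whose product
  -- with its conjugate `2 s re(a) + t - s X` is the resultant `D`.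
  have hP : C D⁻¹ * (C (2 * s * a.re + t) - C s * X) * conjPolynomial b
      = 1 + C D⁻¹ * (C (2 * s * a.re + t) - C s * X - C (s ^ 2)) * conjPolynomial a := by
    have hDC : (C D⁻¹ * C D : ℝ[X]) = 1 := by rw [← C_mul, inv_mul_cancel₀ hD0, C_1]
    rw [← hDC, hb, hD, conjPolynomial]
    simp only [C_mul, C_add, C_pow]
    ring
  refine ⟨C D⁻¹ * (C (2 * s * a.re + t) - C s * X) * conjPolynomial b, fun x hx => ?_,
    fun x hx => ?_⟩
  · rw [hP, map_add, map_mul _ _ (conjPolynomial a), aeval_conjPolynomial hx, mul_zero, add_zero,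
      map_one]
  · rw [map_mul, aeval_conjPolynomial hx, mul_zero]

/-- Real polynomials separate finitely many conjugacy classes of quaternions. -/
lemma exists_separating (K : Finset (ℝ × ℝ)) (k : ℝ × ℝ) :
    ∃ P : ℝ[X], ∀ x, conjInvariants x ∈ K → aeval x P = if k = conjInvariants x then 1 else 0 := by
  classical
  have hpair : ∀ l : ℝ × ℝ, ∃ P : ℝ[X], (∀ x, conjInvariants x = k → aeval x P = 1) ∧
      (l ≠ k → ∀ x, conjInvariants x = l → aeval x P = 0) := fun l => by
    by_cases hl : ∃ b, conjInvariants b = l ∧ l ≠ k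
    · obtain ⟨b, rfl, hb⟩ := hl
      by_cases hk : ∃ a, conjInvariants a = k
      · obtain ⟨a, rfl⟩ := hk
        obtain ⟨P, h1, h0⟩ := exists_separating_pair hb.symm
        exact ⟨P, h1, fun _ => h0⟩
      · exact ⟨0, fun x hx => (hk ⟨x, hx⟩).elim, by simp⟩
    -- The value 1 makes the factor at `l = k`, or at an unattained `l`, harmless in the product.
    · exact ⟨1, by simp, fun hlk x hx => (hl ⟨x, hx, hlk⟩).elim⟩
  choose P h1 h0 using hpair
  refine ⟨∏ l ∈ K, P l, fun x hx => ?_⟩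
  split_ifs with hk
  · have hp : ∀ S : Finset (ℝ × ℝ), aeval x (∏ l ∈ S, P l) = 1 := fun S => by
      induction S using Finset.induction_on with
      | empty => simp
      | insert l S hl ih => rw [Finset.prod_insert hl, map_mul, ih, h1 l x hk.symm, mul_one]
    exact hp K
  · rw [← Finset.mul_prod_erase K P hx, map_mul, h0 _ (Ne.symm hk) x rfl, zero_mul]

/-! ### Interpolation within one class -/

/-- Two left conditions at distinct points are met by a linear polynomial. -/
lemma exists_linear_left {a₁ a₂ : ℍ[ℝ]} (h : a₁ ≠ a₂) (c₁ c₂ : ℍ[ℝ]) :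
    ∃ u v : ℍ[ℝ], u + a₁ * v = c₁ ∧ u + a₂ * v = c₂ := by
  refine ⟨c₁ - a₁ * ((a₁ - a₂)⁻¹ * (c₁ - c₂)), (a₁ - a₂)⁻¹ * (c₁ - c₂), by abel, ?_⟩
  have : (a₁ - a₂) * ((a₁ - a₂)⁻¹ * (c₁ - c₂)) = c₁ - c₂ := mul_inv_cancel_left₀ (sub_ne_zero.2 h) _
  rw [sub_mul] at this
  rw [← sub_eq_zero, sub_add, this]
  abel

/-- Two right conditions at distinct points are met by a linear polynomial. -/
lemma exists_linear_right {b₁ b₂ : ℍ[ℝ]} (h : b₁ ≠ b₂) (d₁ d₂ : ℍ[ℝ]) :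
    ∃ u v : ℍ[ℝ], u + v * b₁ = d₁ ∧ u + v * b₂ = d₂ := by
  refine ⟨d₁ - (d₁ - d₂) * (b₁ - b₂)⁻¹ * b₁, (d₁ - d₂) * (b₁ - b₂)⁻¹, by abel, ?_⟩
  have : (d₁ - d₂) * (b₁ - b₂)⁻¹ * (b₁ - b₂) = d₁ - d₂ :=
    inv_mul_cancel_right₀ (sub_ne_zero.2 h) _
  rw [mul_sub] at this
  rw [← sub_eq_zero, sub_add, this]
  abel

/-- One left and one right condition at equivalent nonreal points are met by a linear polynomial
as soon as they are compatible. -/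
lemma exists_linear_left_right {a b : ℍ[ℝ]} (ha : star a ≠ a) {c d : ℍ[ℝ]}
    (h : star a * (c - d) = (c - d) * b) :
    ∃ u v : ℍ[ℝ], u + a * v = c ∧ u + v * b = d := by
  have hne : a - star a ≠ 0 := sub_ne_zero.2 ha.symm
  refine ⟨c - a * ((a - star a)⁻¹ * (c - d)), (a - star a)⁻¹ * (c - d), by abel, ?_⟩
  have hc : Commute a (a - star a)⁻¹ := by
    refine Commute.inv_right₀ (Commute.sub_right (Commute.refl a) ?_)
    rw [Commute, SemiconjBy, Quaternion.star_mul_self, Quaternion.self_mul_star]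
  -- Compatibility turns `(c - d) * b` into `star a * (c - d)`, leaving the factor `a - star a` to
  -- cancel.
  have e : a * ((a - star a)⁻¹ * (c - d)) - (a - star a)⁻¹ * (c - d) * b = c - d := by
    rw [← mul_assoc, hc.eq, mul_assoc, mul_assoc, ← h, ← mul_sub, ← sub_mul,
      inv_mul_cancel_left₀ hne]
  rw [← sub_eq_zero, sub_add, e]
  abel

/-- Subtracting the relations gives `(star a₁ - star a₂) * (d' - d) = 0`. Thus two left values in a
class determine every right value there, even at a shared node. -/
lemma right_value_unique {a₁ a₂ b c₁ c₂ d d' : ℍ[ℝ]} (h : a₁ ≠ a₂)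
    (h₁ : star a₁ * (c₁ - d) = (c₁ - d) * b) (h₂ : star a₂ * (c₂ - d) = (c₂ - d) * b)
    (h₁' : star a₁ * (c₁ - d') = (c₁ - d') * b) (h₂' : star a₂ * (c₂ - d') = (c₂ - d') * b) :
    d = d' := by
  have e₁ : star a₁ * (d' - d) = (d' - d) * b := by
    rw [show d' - d = (c₁ - d) - (c₁ - d') by abel, mul_sub, sub_mul, h₁, h₁']
  have e₂ : star a₂ * (d' - d) = (d' - d) * b := by
    rw [show d' - d = (c₂ - d) - (c₂ - d') by abel, mul_sub, sub_mul, h₂, h₂']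
  have e : (star a₁ - star a₂) * (d' - d) = 0 := by rw [sub_mul, e₁, e₂, sub_self]
  rcases mul_eq_zero.1 e with e | e
  · exact (h (star_injective (sub_eq_zero.1 e))).elim
  · exact (sub_eq_zero.1 e).symm

lemma left_value_unique {a b₁ b₂ c c' d₁ d₂ : ℍ[ℝ]} (h : b₁ ≠ b₂)
    (h₁ : star a * (c - d₁) = (c - d₁) * b₁) (h₂ : star a * (c - d₂) = (c - d₂) * b₂)
    (h₁' : star a * (c' - d₁) = (c' - d₁) * b₁) (h₂' : star a * (c' - d₂) = (c' - d₂) * b₂) :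
    c = c' := by
  have e₁ : star a * (c - c') = (c - c') * b₁ := by
    rw [show c - c' = (c - d₁) - (c' - d₁) by abel, mul_sub, sub_mul, h₁, h₁']
  have e₂ : star a * (c - c') = (c - c') * b₂ := by
    rw [show c - c' = (c - d₂) - (c' - d₂) by abel, mul_sub, sub_mul, h₂, h₂']
  have e : (c - c') * (b₁ - b₂) = 0 := by rw [mul_sub, ← e₁, ← e₂, sub_self]
  rcases mul_eq_zero.1 e with e | e
  · exact sub_eq_zero.1 e
  · exact (h (sub_eq_zero.1 e)).elim

lemma star_mul_linear_sub {a b : ℍ[ℝ]} (h : conjInvariants a = conjInvariants b) (u v : ℍ[ℝ]) :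
    star a * ((u + a * v) - (u + v * b)) = ((u + a * v) - (u + v * b)) * b := by
  rw [add_sub_add_left_eq_sub]
  exact star_mul_sub_eq h v

lemma NoThreeEquivalent.eq_or_eq {S : Set ℍ[ℝ]} (hS : NoThreeEquivalent S) {x y z : ℍ[ℝ]}
    (hx : x ∈ S) (hy : y ∈ S) (hz : z ∈ S) (hxy : conjInvariants x = conjInvariants y)
    (hyz : conjInvariants y = conjInvariants z) (hne : x ≠ y) : z = x ∨ z = y := by
  by_contra! hzz
  exact hS x hx y hy z hz hne hzz.2.symm hzz.1.symm
    ⟨isConj_iff_conjInvariants_eq.2 hxy, isConj_iff_conjInvariants_eq.2 hyz⟩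

/-- The interpolation conditions in a single conjugacy class are met by a linear polynomial. -/
lemma exists_linear_solution {n m : ℕ} {α c : Fin n → ℍ[ℝ]} {β d : Fin m → ℍ[ℝ]}
    (hα : Function.Injective α) (hβ : Function.Injective β)
    (hreal : ∀ j, ∀ x : ℝ, β j ≠ (x : ℍ[ℝ]))
    (hA : NoThreeEquivalent (Set.range α ∪ Set.range β))
    (h : ∀ i j, conjInvariants (α i) = conjInvariants (β j) →
      star (α i) * (c i - d j) = (c i - d j) * β j) (k : ℝ × ℝ) :
    ∃ u v : ℍ[ℝ], (∀ i, conjInvariants (α i) = k → u + α i * v = c i) ∧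
      ∀ j, conjInvariants (β j) = k → u + v * β j = d j := by
  have mα : ∀ i, α i ∈ Set.range α ∪ Set.range β := fun i => Or.inl ⟨i, rfl⟩
  have mβ : ∀ j, β j ∈ Set.range α ∪ Set.range β := fun j => Or.inr ⟨j, rfl⟩
  by_cases h1 : ∃ i₁ i₂, i₁ ≠ i₂ ∧ conjInvariants (α i₁) = k ∧ conjInvariants (α i₂) = k
  · obtain ⟨i₁, i₂, hne, hi₁, hi₂⟩ := h1
    have hne' : α i₁ ≠ α i₂ := hα.ne hne
    obtain ⟨u, v, e₁, e₂⟩ := exists_linear_left hne' (c i₁) (c i₂)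
    refine ⟨u, v, fun i hi => ?_, fun j hj => ?_⟩
    · rcases hA.eq_or_eq (mα i₁) (mα i₂) (mα i) (hi₁.trans hi₂.symm) (hi₂.trans hi.symm) hne'
        with e | e
      · rw [hα e, e₁]
      · rw [hα e, e₂]
    · have g₁ := hi₁.trans hj.symm
      have g₂ := hi₂.trans hj.symm
      refine right_value_unique hne' ?_ ?_ (h i₁ j g₁) (h i₂ j g₂)
      · rw [← e₁]; exact star_mul_linear_sub g₁ u v
      · rw [← e₂]; exact star_mul_linear_sub g₂ u v
  by_cases h2 : ∃ j₁ j₂, j₁ ≠ j₂ ∧ conjInvariants (β j₁) = k ∧ conjInvariants (β j₂) = k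
  · obtain ⟨j₁, j₂, hne, hj₁, hj₂⟩ := h2
    have hne' : β j₁ ≠ β j₂ := hβ.ne hne
    obtain ⟨u, v, e₁, e₂⟩ := exists_linear_right hne' (d j₁) (d j₂)
    refine ⟨u, v, fun i hi => ?_, fun j hj => ?_⟩
    · have g₁ := hi.trans hj₁.symm
      have g₂ := hi.trans hj₂.symm
      refine left_value_unique hne' ?_ ?_ (h i j₁ g₁) (h i j₂ g₂)
      · rw [← e₁]; exact star_mul_linear_sub g₁ u v
      · rw [← e₂]; exact star_mul_linear_sub g₂ u v
    · rcases hA.eq_or_eq (mβ j₁) (mβ j₂) (mβ j) (hj₁.trans hj₂.symm) (hj₂.trans hj.symm) hne'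
        with e | e
      · rw [hβ e, e₁]
      · rw [hβ e, e₂]
  have s1 : ∀ i i', conjInvariants (α i) = k → conjInvariants (α i') = k → i = i' :=
    fun i i' hi hi' => by_contra fun hn => h1 ⟨i, i', hn, hi, hi'⟩
  have s2 : ∀ j j', conjInvariants (β j) = k → conjInvariants (β j') = k → j = j' :=
    fun j j' hj hj' => by_contra fun hn => h2 ⟨j, j', hn, hj, hj'⟩
  by_cases hi : ∃ i, conjInvariants (α i) = k
  · obtain ⟨i, hi⟩ := hi
    by_cases hj : ∃ j, conjInvariants (β j) = k
    · obtain ⟨j, hj⟩ := hj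
      -- A real `α i` is alone in its class, so `β j` would be real.
      have hs : star (α i) ≠ α i := fun hs => by
        have hq := Quaternion.star_eq_self.1 hs
        have hconj := isConj_iff_conjInvariants_eq.2 (hi.trans hj.symm)
        obtain ⟨w, hw, e⟩ := GroupWithZero.isConj_iff₀.1 hconj
        refine hreal j (α i).re ?_
        rw [← e, hq, ← Quaternion.coe_commutes, mul_assoc, mul_inv_cancel₀ hw, mul_one,
          Quaternion.re_coe]
      obtain ⟨u, v, e₁, e₂⟩ := exists_linear_left_right hs (h i j (hi.trans hj.symm))
      exact ⟨u, v, fun i' hi' => by rw [s1 i' i hi' hi, e₁],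
        fun j' hj' => by rw [s2 j' j hj' hj, e₂]⟩
    · exact ⟨c i, 0, fun i' hi' => by rw [s1 i' i hi' hi, mul_zero, add_zero],
        fun j hj' => (hj ⟨j, hj'⟩).elim⟩
  · by_cases hj : ∃ j, conjInvariants (β j) = k
    · obtain ⟨j, hj⟩ := hj
      exact ⟨d j, 0, fun i hi' => (hi ⟨i, hi'⟩).elim,
        fun j' hj' => by rw [s2 j' j hj' hj, zero_mul, add_zero]⟩
    · exact ⟨0, 0, fun i hi' => (hi ⟨i, hi'⟩).elim, fun j hj' => (hj ⟨j, hj'⟩).elim⟩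

theorem theoremT (n m : ℕ) (α c : Fin n → ℍ[ℝ]) (β d : Fin m → ℍ[ℝ])
    (hα : Function.Injective α) (hβ : Function.Injective β)
    (hreal : ∀ j, ∀ x : ℝ, β j ≠ (x : ℍ[ℝ]))
    (hA : NoThreeEquivalent (Set.range α ∪ Set.range β)) :
    (∃ f : ℍ[ℝ][X], SolvesTwoSidedLagrange α c β d f) ↔
      ∀ i j, IsConj (α i) (β j) → star (α i) * (c i - d j) = (c i - d j) * β j := by
  classical
  constructor
  · rintro ⟨f, hl, hr⟩ i j hij
    rw [← hl i, ← hr j]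
    exact star_mul_leftEval_sub_eval (conjInvariants_eq_of_isConj hij) f
  · intro h
    choose u v hu hv using exists_linear_solution hα hβ hreal hA
      fun i j hij => h i j (isConj_iff_conjInvariants_eq.2 hij)
    let K : Finset (ℝ × ℝ) := Finset.univ.image (fun i => conjInvariants (α i)) ∪
      Finset.univ.image fun j => conjInvariants (β j)
    choose P hP using exists_separating K
    -- At a node, only the summand of its own class survives, with weight 1.
    refine ⟨∑ k ∈ K, (P k).map (algebraMap ℝ ℍ[ℝ]) * (C (u k) + X * C (v k)),
      fun i => ?_, fun j => ?_⟩
    · have hi : conjInvariants (α i) ∈ K :=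
        Finset.mem_union_left _ (Finset.mem_image_of_mem _ (Finset.mem_univ i))
      simp only [leftEval_sum, leftEval_map_mul, leftEval_linear, hP _ _ hi, ite_mul, one_mul,
        zero_mul]
      rw [Finset.sum_ite_eq' K, if_pos hi, hu _ i rfl]
    · have hj : conjInvariants (β j) ∈ K :=
        Finset.mem_union_right _ (Finset.mem_image_of_mem _ (Finset.mem_univ j))
      simp only [eval_finsetSum, eval_map_mul, X_mul_C, eval_add, eval_C, eval_mul_X, hP _ _ hj,
        mul_ite, mul_one, mul_zero]
      rw [Finset.sum_ite_eq' K, if_pos hj, hv _ j rfl]
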